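/- Let $k$ be a field and let $\mathcal B$ be a skeletally small, Krull–Schmidt, $k$-linear exact category (in the sense of Quillen) with enough projectives and enough injectives, and let $\mathcal P$ be its full subcategory of projective objects. A cotorsion pair on $\mathcal B$ is a pair $(\mathcal U,\mathcal V)$ of full additive subcategories closed under direct summands such that $\operatorname{Ext}^1_{\mathcal B}(U,V)=0$ for all $U\in\mathcal U$, $V\in\mathcal V$, and such that every $B\in\mathcal B$ admits short exact sequences $V_B\rightarrowtail U_B\twoheadrightarrow B$ and $B\rightarrowtail V^B\twoheadrightarrow U^B$ with $U_B,U^B\in\mathcal U$ and $V_B,V^B\in\mathcal V$. Let $(\mathcal S,\mathcal T),(\mathcal T,\mathcal V)$ be a twin cotorsion pair on $\mathcal B$, that is, $(\mathcal S,\mathcal T)$ and $(\mathcal T,\mathcal V)$ are cotorsion pairs and $\mathcal S\subseteq\mathcal T$. Let $\mathcal B/\mathcal T$ be the quotient of $\mathcal B$ by the ideal of morphisms that factor through an object of $\mathcal T$, let $R$ be the class of morphisms of $\mathcal B/\mathcal T$ that are both monomorphisms and epimorphisms, and let $(\mathcal B/\mathcal T)_R$ be the Gabriel–Zisman localisation of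 $\mathcal B/\mathcal T$ at $R$. Let $\Omega\mathcal S$ be the full subcategory of $\mathcal B$ of the objects $X$ for which there is a short exact sequence $X\rightarrowtail P\twoheadrightarrow S$ with $P\in\mathcal P$ and $S\in\mathcal S$, and let $\Omega\mathcal S/\mathcal P$ be its quotient by the ideal of morphisms that factor through an object of $\mathcal P$. For a $k$-linear category $\mathcal C$, let $\operatorname{mod}\mathcal C$ be the category of contravariant additive functors $F$ from $\mathcal C$ to $k$-vector spaces that admit an exact sequence $\operatorname{Hom}_{\mathcal C}(-,C_1)\to\operatorname{Hom}_{\mathcal C}(-,C_0)\to F\to 0$ with $C_0,C_1\in\mathcal C$. Then there is an equivalence of categories $$(\mathcal B/\mathcal T)_R\simeq \operatorname{mod}(\Omega\mathcal S/\mathcal P).$$ -/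

import Mathlib

open CategoryTheory CategoryTheory.Limits

universe v u w

namespace TwinCotorsion

/-! ### Additive subcategories and quotients by them -/

section Quotients

variable {B : Type u} [Category.{v} B] [Preadditive B] [HasBinaryBiproducts B]

/-- The full subcategory of `B` on the objects satisfying `W` is an additive subcategory: it
contains the zero objects and is closed under (binary, hence all finite) direct sums. -/
class IsAdditiveSubcategory (W : ObjectProperty B) : Prop where
  zero : ∀ Z : B, IsZero Z → W Z
  biprod : ∀ X Y : B, W X → W Y → W (X ⊞ Y)

/-- `W` is closed under direct summands (in particular, under isomorphisms). -/
def ClosedUnderSummands (W : ObjectProperty B) : Prop :=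
  ∀ X Y Z : B, Nonempty (Z ≅ X ⊞ Y) → W Z → W X

/-- Two parallel morphisms are identified when their difference factors through an object
of `W`. -/
def factorRel {B : Type u} [Category.{v} B] [Preadditive B] (W : ObjectProperty B) : HomRel B :=
  fun X Y f g => ∃ (Z : B) (a : X ⟶ Z) (b : Z ⟶ Y), W Z ∧ f - g = a ≫ b

/-- The quotient category `B/W`: same objects as `B`, morphisms are the morphisms of `B` modulo
those that factor through an object of `W`. -/
abbrev QuotientBy {B : Type u} [Category.{v} B] [Preadditive B] (W : ObjectProperty B) : Type u := Quotient (factorRel W)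

lemma factorRel_add (W : ObjectProperty B) [IsAdditiveSubcategory W] ⦃X Y : B⦄
    (f₁ f₂ g₁ g₂ : X ⟶ Y) (h : factorRel W f₁ f₂) (h' : factorRel W g₁ g₂) :
    factorRel W (f₁ + g₁) (f₂ + g₂) := by
  obtain ⟨Z, a, b, hZ, e⟩ := h
  obtain ⟨Z', a', b', hZ', e'⟩ := h'
  refine ⟨Z ⊞ Z', biprod.lift a a', biprod.desc b b',
    IsAdditiveSubcategory.biprod _ _ hZ hZ', ?_⟩
  rw [biprod.lift_desc, ← e, ← e']
  abel

lemma factorRel_smul {B : Type u} [Category.{v} B] [Preadditive B] {k : Type w} [Ring k]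
    [Linear k B] (W : ObjectProperty B)
    (c : k) ⦃X Y : B⦄ (f g : X ⟶ Y) (h : factorRel W f g) :
    factorRel W (c • f) (c • g) := by
  obtain ⟨Z, a, b, hZ, e⟩ := h
  exact ⟨Z, c • a, b, hZ, by rw [← smul_sub, e, Linear.smul_comp]⟩

instance [HasZeroObject B] (W : ObjectProperty B) [IsAdditiveSubcategory W] : Congruence (factorRel W) where
  comp_left := by
    rintro X Y Z f g g' ⟨A, a, b, hA, e⟩
    exact ⟨A, f ≫ a, b, hA, by rw [← Preadditive.comp_sub, e, Category.assoc]⟩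
  comp_right := by
    rintro X Y Z f f' g ⟨A, a, b, hA, e⟩
    exact ⟨A, a, b ≫ g, hA, by rw [← Preadditive.sub_comp, e, Category.assoc]⟩
  equivalence := by
    intro X Y
    refine ⟨fun f => ?_, ?_, ?_⟩
    · obtain ⟨Z, hZ⟩ := HasZeroObject.zero (C := B)
      exact ⟨Z, 0, 0, IsAdditiveSubcategory.zero Z hZ, by simp⟩
    · rintro f g ⟨A, a, b, hA, e⟩
      exact ⟨A, -a, b, hA, by rw [Preadditive.neg_comp, ← e, neg_sub]⟩
    · rintro f g h ⟨A, a, b, hA, e⟩ ⟨A', a', b', hA', e'⟩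
      refine ⟨A ⊞ A', biprod.lift a a', biprod.desc b b',
        IsAdditiveSubcategory.biprod _ _ hA hA', ?_⟩
      rw [biprod.lift_desc, ← e, ← e']
      abel

instance [HasZeroObject B] (W : ObjectProperty B) [IsAdditiveSubcategory W] : Preadditive (QuotientBy W) :=
  Quotient.preadditive _ (factorRel_add W)

instance [HasZeroObject B] (W : ObjectProperty B) [IsAdditiveSubcategory W] :
    (Quotient.functor (factorRel W)).Additive :=
  Quotient.functor_additive _ (factorRel_add W)

instance [HasZeroObject B] (k : Type w) [Ring k] [Linear k B] (W : ObjectProperty B)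
    [IsAdditiveSubcategory W] :
    Linear k (QuotientBy W) :=
  Quotient.linear k _ (factorRel_smul W)

/-- `B` is Krull–Schmidt: every object is a finite direct sum of objects with local endomorphism
rings. -/
def IsKrullSchmidt (B : Type u) [Category.{v} B] [Preadditive B] : Prop :=
  ∀ X : B, ∃ (n : ℕ) (Y : Fin n → B) (b : Bicone Y),
    (∀ i, IsLocalRing (End (Y i))) ∧ Nonempty b.IsBilimit ∧ Nonempty (X ≅ b.pt)

end Quotients

/-! ### Exact categories -/

/-- `S` is a weak short exact sequence: `S.f` is a kernel of `S.g` and `S.g` is a cokernel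
of `S.f`. -/
def IsWeakShortExact {B : Type u} [Category.{v} B] [Preadditive B] (S : ShortComplex B) : Prop :=
  Nonempty (IsLimit (KernelFork.ofι S.f S.zero)) ∧
    Nonempty (IsColimit (CokernelCofork.ofπ S.g S.zero))

/-- `i` is the first morphism of a sequence of the class `conf`. -/
def IsInflation {B : Type u} [Category.{v} B] [Preadditive B]
    (conf : ObjectProperty (ShortComplex B)) : MorphismProperty B :=
  fun _ Y i => ∃ (Z : B) (d : Y ⟶ Z) (h : i ≫ d = 0), conf (ShortComplex.mk i d h)

/-- `d` is the second morphism of a sequence of the class `conf`. -/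
def IsDeflation {B : Type u} [Category.{v} B] [Preadditive B]
    (conf : ObjectProperty (ShortComplex B)) : MorphismProperty B :=
  fun Y _ d => ∃ (X : B) (i : X ⟶ Y) (h : i ≫ d = 0), conf (ShortComplex.mk i d h)

/-- An exact structure (in the sense of Quillen) on an additive category. The members of `conf`
are the short exact sequences. -/
structure ExactStructure (B : Type u) [Category.{v} B] [Preadditive B]
    [HasZeroObject B] [HasBinaryBiproducts B] where
  conf : ObjectProperty (ShortComplex B)
  weak : ∀ S, conf S → IsWeakShortExact S
  of_iso : ∀ S S' : ShortComplex B, Nonempty (S ≅ S') → conf S → conf S'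
  /-- Direct sums of short exact sequences are short exact. -/
  direct_sum : ∀ S S' : ShortComplex B, conf S → conf S' →
    conf (ShortComplex.mk (biprod.map S.f S'.f) (biprod.map S.g S'.g) (by ext <;> simp))
  /-- Direct summands of short exact sequences are short exact. -/
  direct_summand : ∀ S S' : ShortComplex B,
    conf (ShortComplex.mk (biprod.map S.f S'.f) (biprod.map S.g S'.g) (by ext <;> simp)) → conf S
  id_inflation : ∀ X : B, IsInflation conf (𝟙 X)
  id_deflation : ∀ X : B, IsDeflation conf (𝟙 X)
  comp_inflation : ∀ {X Y Z : B} (f : X ⟶ Y) (g : Y ⟶ Z),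
    IsInflation conf f → IsInflation conf g → IsInflation conf (f ≫ g)
  comp_deflation : ∀ {X Y Z : B} (f : X ⟶ Y) (g : Y ⟶ Z),
    IsDeflation conf f → IsDeflation conf g → IsDeflation conf (f ≫ g)
  exists_pullback : ∀ {Y Z Z' : B} (d : Y ⟶ Z) (f : Z' ⟶ Z), IsDeflation conf d →
    ∃ (Y' : B) (f' : Y' ⟶ Y) (d' : Y' ⟶ Z'), IsPullback f' d' d f ∧ IsDeflation conf d'
  exists_pushout : ∀ {X Y X' : B} (i : X ⟶ Y) (g : X ⟶ X'), IsInflation conf i →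
    ∃ (Y' : B) (g' : Y ⟶ Y') (i' : X' ⟶ Y'), IsPushout i g g' i' ∧ IsInflation conf i'

namespace ExactStructure

variable {B : Type u} [Category.{v} B] [Preadditive B] [HasZeroObject B] [HasBinaryBiproducts B]
  (E : ExactStructure B)

/-- The projective objects of the exact category. -/
def projectives : ObjectProperty B := fun P =>
  ∀ ⦃X Y : B⦄ (f : X ⟶ Y) (g : P ⟶ Y), IsDeflation E.conf f → ∃ h : P ⟶ X, h ≫ f = g

/-- The injective objects of the exact category. -/
def injectives : ObjectProperty B := fun I =>
  ∀ ⦃X Y : B⦄ (f : X ⟶ Y) (g : X ⟶ I), IsInflation E.conf f → ∃ h : Y ⟶ I, f ≫ h = g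

def EnoughProjectives : Prop :=
  ∀ X : B, ∃ (P : B) (p : P ⟶ X), E.projectives P ∧ IsDeflation E.conf p

def EnoughInjectives : Prop :=
  ∀ X : B, ∃ (I : B) (i : X ⟶ I), E.injectives I ∧ IsInflation E.conf i

instance : IsAdditiveSubcategory E.projectives where
  zero Z hZ _ _ _ _ _ := ⟨0, hZ.eq_of_src _ _⟩
  biprod P Q hP hQ X Y f g hf := by
    obtain ⟨a, ha⟩ := hP f (biprod.inl ≫ g) hf
    obtain ⟨b, hb⟩ := hQ f (biprod.inr ≫ g) hf
    exact ⟨biprod.desc a b, by ext <;> simp [ha, hb]⟩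

/-- `Ext¹(X, Y) = 0`: every short exact sequence `Y ↣ M ↠ X` splits. -/
def ExtOneVanishes (X Y : B) : Prop :=
  ∀ (M : B) (i : Y ⟶ M) (d : M ⟶ X) (h : i ≫ d = 0), E.conf (ShortComplex.mk i d h) →
    Nonempty (ShortComplex.mk i d h).Splitting

/-- `(U, V)` is a cotorsion pair. -/
structure IsCotorsionPair (U V : ObjectProperty B) : Prop where
  additive_left : IsAdditiveSubcategory U
  additive_right : IsAdditiveSubcategory V
  summands_left : ClosedUnderSummands U
  summands_right : ClosedUnderSummands V
  ext_vanishes : ∀ X Y : B, U X → V Y → E.ExtOneVanishes X Y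
  exists_right : ∀ X : B, ∃ (VX UX : B) (i : VX ⟶ UX) (d : UX ⟶ X) (h : i ≫ d = 0),
    E.conf (ShortComplex.mk i d h) ∧ U UX ∧ V VX
  exists_left : ∀ X : B, ∃ (VX UX : B) (i : X ⟶ VX) (d : VX ⟶ UX) (h : i ≫ d = 0),
    E.conf (ShortComplex.mk i d h) ∧ U UX ∧ V VX

/-- `(S, T), (U, V)` is a twin cotorsion pair. -/
structure IsTwinCotorsionPair (S T U V : ObjectProperty B) : Prop where
  left : E.IsCotorsionPair S T
  right : E.IsCotorsionPair U V
  le : S ≤ U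

/-- `ΩC`: the objects `X` admitting a short exact sequence `X ↣ P ↠ Y` with `P` projective and
`Y` in `C`. -/
def syzygies (C : ObjectProperty B) : ObjectProperty B := fun X =>
  ∃ (P Y : B) (i : X ⟶ P) (d : P ⟶ Y) (h : i ≫ d = 0),
    E.conf (ShortComplex.mk i d h) ∧ E.projectives P ∧ C Y

/-- The category `ΩC/𝒫`: objects are those of `ΩC`, morphisms are the morphisms of `B` modulo those
factoring through a projective object. (It is realised as the full subcategory of the stable
category `B/𝒫` on the objects of `ΩC`.) -/
abbrev StableSyzygies (C : ObjectProperty B) : Type u :=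
  ObjectProperty.FullSubcategory (C := QuotientBy E.projectives) (fun X => E.syzygies C X.as)

end ExactStructure

/-! ### Finitely presented functors and regular morphisms -/

/-- A contravariant additive functor from `C` to `k`-modules is finitely presented if there is an
exact sequence `Hom(-, C₁) ⟶ Hom(-, C₀) ⟶ F ⟶ 0`. -/
def isFinitelyPresented (k : Type w) [Field k] (C : Type u) [Category.{v} C] [Preadditive C]
    [Linear k C] : ObjectProperty (Cᵒᵖ ⥤ ModuleCat.{v} k) := fun F =>
  F.Additive ∧ ∃ (C₁ C₀ : C) (β : (linearYoneda k C).obj C₁ ⟶ (linearYoneda k C).obj C₀)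
    (α : (linearYoneda k C).obj C₀ ⟶ F) (h : β ≫ α = 0),
    (ShortComplex.mk β α h).Exact ∧ Epi α

/-- The category `mod C` of finitely presented contravariant functors on `C`. -/
abbrev FinPresFunctor (k : Type w) [Field k] (C : Type u) [Category.{v} C] [Preadditive C]
    [Linear k C] :=
  (isFinitelyPresented k C).FullSubcategory

/-- The regular morphisms of a category: those that are both monomorphisms and epimorphisms. -/
def regularMorphisms (C : Type u) [Category.{v} C] : MorphismProperty C :=
  fun _ _ f => Mono f ∧ Epi f

end TwinCotorsion

/-!
The functor `X ↦ Hom_{B/T}(-, X)|_{ΩS}` from `B/T` to `mod (ΩS/𝒫)` is the localisation of `B/T` at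
the regular morphisms. The proof separates the categorical part from the exact structure.

*Exact structure.* If `D ↣ P ↠ Z` is a conflation with `P` projective and `Z` in `S`, then
`Ext¹(Z, T) = 0` makes every morphism from `D` to an object of `T` extend to `P`. Therefore a morphism
from `D` vanishes in `B/T` if and only if it extends to `P`, and `ΩS/𝒫` is a full subcategory of `B/T`
(`IsCotorsionPair.faithful_syzygyInclusion`). Lifting and pushing out conflations then gives four
properties of this subcategory (`IsCotorsionPair.isGeneratingInclusion`): every object `X` of `B/T`
has an epimorphic right approximation by a syzygy, obtained from the conflation `X ↣ TX ↠ SX`;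
morphisms have weak kernels as seen from the syzygies; syzygies are projective with respect to
epimorphisms of `B/T`; and a morphism of syzygies `D₁ ⟶ D` has a weak cokernel, the pushout of
`D₁ ↣ P₁`, on which the functor takes the value `coker (Hom(-, D₁) ⟶ Hom(-, D))`.

*Categorical part.* Let `J : D ⥤ C` be the inclusion of a full subcategory with these properties. By
approximations and weak kernels the functors `Hom(J -, X)` are finitely presented; since
approximations are epimorphisms the functor `X ↦ Hom(J -, X)` is faithful; by weak cokernels it is
essentially surjective; and it inverts regular morphisms because `D` is projective. Given a morphism
`φ` from `Hom(J -, X)` to `Hom(J -, Y)`, the weak cokernel `W` of a morphism that presents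
`Hom(J -, X)` has a regular morphism `s : W ⟶ X`, and `φ` composed with the image of `s` comes from a
morphism `W ⟶ Y` (`IsGeneratingInclusion.exists_fraction`). Being faithful with every morphism of its
target a right fraction, the functor is a localisation
(`CategoryTheory.Functor.isLocalization_of_rightFractions`).
-/

/-! ### Localisations through right fractions -/

namespace CategoryTheory

open MorphismProperty

/-- A faithful, essentially surjective functor `L` is a localisation at a class `W` of monomorphisms
that it inverts as soon as every morphism in its target is a right fraction. The Ore condition
for `W` is obtained by writing `L(s)⁻¹ ∘ L(f)` as a fraction and using that `L` is faithful. -/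
theorem Functor.isLocalization_of_rightFractions {C M : Type*} [Category* C] [Category* M]
    (L : C ⥤ M) [L.Faithful] [L.EssSurj] (W : MorphismProperty C) [W.IsMultiplicative]
    (hmono : ∀ ⦃X Y : C⦄ (s : X ⟶ Y), W s → Mono s) (hinv : W.IsInvertedBy L)
    (hfrac : ∀ ⦃X Y : C⦄ (φ : L.obj X ⟶ L.obj Y), ∃ (X' : C) (s : X' ⟶ X) (g : X' ⟶ Y),
      W s ∧ L.map s ≫ φ = L.map g) :
    L.IsLocalization W := by
  have : W.HasRightCalculusOfFractions :=
    { exists_rightFraction := by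
        intro X Y z
        have := hinv _ z.hs
        obtain ⟨X', s, g, hs, e⟩ := hfrac (L.map z.f ≫ CategoryTheory.inv (L.map z.s))
        refine ⟨⟨s, hs, g⟩, L.map_injective ?_⟩
        simp [← e]
      ext := by
        intro X Y Y' f₁ f₂ s hs e
        have := hmono s hs
        exact ⟨X, 𝟙 X, W.id_mem X, by rw [(cancel_mono s).1 e]⟩ }
  let G := Localization.Construction.lift L hinv
  have hmap : ∀ {X Y : C} (f : X ⟶ Y), G.map (W.Q.map f) = L.map f := fun f =>
    (Functor.congr_hom (Localization.Construction.fac L hinv) f).trans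
      ((Category.id_comp _).trans (Category.comp_id _))
  have hess : W.Q.EssSurj := Localization.essSurj W.Q W
  have hess' : G.EssSurj :=
    ⟨fun Y => ⟨W.Q.obj (L.objPreimage Y), ⟨L.objObjPreimageIso Y⟩⟩⟩
  have hfaith : G.Faithful := by
    refine G.faithful_of_comp_essSurj W.Q fun X Y f g hfg => ?_
    obtain ⟨a, rfl⟩ := Localization.exists_rightFraction W.Q W f
    -- the second morphism is written as a fraction after passing to the denominator of the first
    obtain ⟨b, hb⟩ := Localization.exists_rightFraction W.Q W (W.Q.map a.s ≫ g)
    rw [← cancel_epi (W.Q.map a.s), a.map_s_comp_map, ← cancel_epi (W.Q.map b.s), hb,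
      b.map_s_comp_map, ← Functor.map_comp]
    congr 1
    apply L.map_injective
    rw [← hmap, ← hmap, Functor.map_comp, ← a.map_s_comp_map W.Q (Localization.inverts W.Q W),
      ← b.map_s_comp_map W.Q (Localization.inverts W.Q W), ← hb]
    simp only [Functor.map_comp, hfg]
    rfl
  have hfull : G.Full := by
    refine G.full_of_comp_essSurj W.Q fun X Y φ => ?_
    obtain ⟨X', s, g, hs, e⟩ := hfrac (X := X) (Y := Y) φ
    obtain ⟨q, hq, -⟩ := (Localization.inverts W.Q W _ hs).out
    have : IsIso (L.map s) := hinv _ hs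
    refine ⟨q ≫ W.Q.map g, ?_⟩
    refine (cancel_epi (L.map s)).1 (Eq.trans ?_ e.symm)
    refine (congrArg (· ≫ _) (hmap s).symm).trans ((G.map_comp _ _).symm.trans ?_)
    rw [reassoc_of% hq, hmap]
  exact { inverts := hinv, isEquivalence := { } }

theorem ShortComplex.exact_iff_evaluation {D A : Type*} [Category* D] [Category* A] [Abelian A]
    (S : ShortComplex (D ⥤ A)) :
    S.Exact ↔ ∀ j, (S.map ((evaluation D A).obj j)).Exact := by
  simp only [ShortComplex.exact_iff_isZero_homology]
  rw [Functor.isZero_iff]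
  exact forall_congr' fun j => (S.mapHomologyIso ((evaluation D A).obj j)).symm.isZero_iff

end CategoryTheory

/-! ### Restricted representable functors -/

namespace TwinCotorsion

open Opposite

variable (k : Type w) [Field k] {C : Type*} {D : Type*} [Category.{v} C] [Category.{v} D]
  [Preadditive C] [Linear k C] (J : D ⥤ C)

/-- The functor sending `X` to the contravariant functor `Hom(J -, X)`. -/
abbrev restrictedYoneda : C ⥤ Dᵒᵖ ⥤ ModuleCat.{v} k :=
  linearYoneda k C ⋙ (Functor.whiskeringLeft _ _ _).obj J.op

/-- The properties of the inclusion `J` of a full subcategory of `C` that make the functor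
`X ↦ Hom(J -, X)` a localisation at the regular morphisms: objects of the subcategory cover all
objects of `C`, and behave like projectives. -/
structure IsGeneratingInclusion : Prop where
  /-- every object has an epimorphic right approximation by the subcategory -/
  exists_approximation (X : C) : ∃ (d : D) (a : J.obj d ⟶ X), Epi a ∧
    ∀ (e : D) (t : J.obj e ⟶ X), ∃ s : e ⟶ d, J.map s ≫ a = t
  /-- every morphism has a kernel up to non-uniqueness, as seen from the subcategory -/
  exists_weakKernel {X Y : C} (f : X ⟶ Y) : ∃ (K : C) (κ : K ⟶ X), κ ≫ f = 0 ∧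
    ∀ (e : D) (t : J.obj e ⟶ X), t ≫ f = 0 → ∃ s : J.obj e ⟶ K, s ≫ κ = t
  /-- the subcategory is projective with respect to all epimorphisms -/
  exists_lift {X Y : C} (f : X ⟶ Y) [Epi f] (e : D) (t : J.obj e ⟶ Y) :
    ∃ s : J.obj e ⟶ X, s ≫ f = t
  /-- every morphism of the subcategory has a weak cokernel in `C`, and
  `Hom(J -, d₁) ⟶ Hom(J -, d) ⟶ Hom(J -, W) ⟶ 0` is exact -/
  exists_weakCokernel {d₁ d : D} (δ : d₁ ⟶ d) : ∃ (W : C) (π : J.obj d ⟶ W),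
    J.map δ ≫ π = 0 ∧
    (∀ (Y : C) (y : J.obj d ⟶ Y), J.map δ ≫ y = 0 → ∃ r : W ⟶ Y, π ≫ r = y) ∧
    (∀ (e : D) (t : J.obj e ⟶ W), ∃ s : e ⟶ d, J.map s ≫ π = t) ∧
    (∀ (e : D) (t : e ⟶ d), J.map t ≫ π = 0 → ∃ s : e ⟶ d₁, s ≫ δ = t)

variable {J}

lemma restrictedYoneda_naturality {F : C} {G : Dᵒᵖ ⥤ ModuleCat.{v} k}
    (φ : (restrictedYoneda k J).obj F ⟶ G) {d e : D} (s : e ⟶ d) (a : J.obj d ⟶ F) :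
    (φ.app (op e)).hom (J.map s ≫ a : J.obj e ⟶ F) = (G.map s.op).hom ((φ.app (op d)).hom a) :=
  congrArg (fun h => h.hom a) (φ.naturality s.op)

namespace IsGeneratingInclusion

variable (hJ : IsGeneratingInclusion J)
include hJ

variable [J.Full]

/-- Every `Hom(J -, X)` has a presentation by representable functors: take an approximation of `X`,
and an approximation of its weak kernel. -/
lemma exists_presentation (X : C) : ∃ (d₁ d : D) (δ : d₁ ⟶ d) (a : J.obj d ⟶ X),
    Epi a ∧ J.map δ ≫ a = 0 ∧
    (∀ (e : D) (t : J.obj e ⟶ X), ∃ s : e ⟶ d, J.map s ≫ a = t) ∧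
    (∀ (e : D) (t : e ⟶ d), J.map t ≫ a = 0 → ∃ s : e ⟶ d₁, J.map (s ≫ δ) = J.map t) := by
  obtain ⟨d, a, ha, has⟩ := hJ.exists_approximation X
  obtain ⟨K, κ, hκ, hκl⟩ := hJ.exists_weakKernel a
  obtain ⟨d₁, b, -, hbs⟩ := hJ.exists_approximation K
  obtain ⟨δ, hδ⟩ := J.map_surjective (b ≫ κ)
  refine ⟨d₁, d, δ, a, ha, by rw [hδ, Category.assoc, hκ, comp_zero], has, fun e t ht => ?_⟩
  obtain ⟨s, hs⟩ := hκl e _ ht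
  obtain ⟨s', hs'⟩ := hbs e s
  exact ⟨s', by rw [J.map_comp, hδ, ← Category.assoc, hs', hs]⟩

/-- A morphism `Hom(J -, X) ⟶ Hom(J -, Y)` is a fraction whose denominator `W ⟶ X` is regular:
`W` is the weak cokernel in `C` of the morphism that presents `Hom(J -, X)`. -/
lemma exists_fraction {X Y : C}
    (φ : (restrictedYoneda k J).obj X ⟶ (restrictedYoneda k J).obj Y) :
    ∃ (W : C) (s : W ⟶ X) (g : W ⟶ Y), regularMorphisms C s ∧
      (restrictedYoneda k J).map s ≫ φ = (restrictedYoneda k J).map g := by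
  obtain ⟨d₁, d, δ, a, ha, h₀, -, hk⟩ := hJ.exists_presentation X
  obtain ⟨W, π, hπ, hπd, hπs, -⟩ := hJ.exists_weakCokernel δ
  obtain ⟨r, hr⟩ := hπd X a h₀
  obtain ⟨g, hg⟩ := hπd Y ((φ.app (op d)).hom a) (by
    refine (restrictedYoneda_naturality k φ δ a).symm.trans ?_
    rw [h₀]
    exact map_zero _)
  refine ⟨W, r, g, ⟨?_, ?_⟩, ?_⟩
  · refine Preadditive.mono_of_cancel_zero _ fun {Z} t ht => ?_
    obtain ⟨e, b, hb, -⟩ := hJ.exists_approximation Z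
    obtain ⟨s, hs⟩ := hπs e (b ≫ t)
    obtain ⟨s', hs'⟩ := hk e s (by rw [← hr, ← Category.assoc, hs, Category.assoc, ht, comp_zero])
    rw [← cancel_epi b, ← hs, ← hs', J.map_comp, Category.assoc, hπ, comp_zero, comp_zero]
  · have : Epi (π ≫ r) := by rwa [hr]
    exact epi_of_epi π r
  · ext e t
    obtain ⟨s, hs⟩ := hπs e.unop t
    subst hs
    change (φ.app e).hom ((J.map s ≫ π) ≫ r) = (J.map s ≫ π) ≫ g
    rw [Category.assoc, Category.assoc, hr, hg]
    exact restrictedYoneda_naturality k φ s a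

end IsGeneratingInclusion

variable [Preadditive D] [Linear k D] [J.Additive] [J.Linear k]

/-- The natural transformation `Hom(-, d) ⟶ Hom(J -, X)` that corresponds to `a : J d ⟶ X` by the
Yoneda lemma. -/
def yonedaToRestricted {d : D} {X : C} (a : J.obj d ⟶ X) :
    (linearYoneda k D).obj d ⟶ (restrictedYoneda k J).obj X where
  app e := ModuleCat.ofHom (Linear.rightComp k (J.obj e.unop) a ∘ₗ J.mapLinearMap k)
  naturality e e' f := by
    ext t
    exact (congrArg (· ≫ a) (J.map_comp f.unop t)).trans (Category.assoc _ _ _)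

/-- The sequence `Hom(-, d₁) ⟶ Hom(-, d) ⟶ Hom(J -, X) ⟶ 0` is exact if it is so objectwise. -/
lemma exact_yonedaToRestricted {d₁ d : D} (δ : d₁ ⟶ d) {X : C} (a : J.obj d ⟶ X)
    (h₀ : J.map δ ≫ a = 0) (hs : ∀ (e : D) (t : J.obj e ⟶ X), ∃ s : e ⟶ d, J.map s ≫ a = t)
    (hk : ∀ (e : D) (t : e ⟶ d), J.map t ≫ a = 0 → ∃ s : e ⟶ d₁, s ≫ δ = t) :
    ∃ h : (linearYoneda k D).map δ ≫ yonedaToRestricted k a = 0,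
      (ShortComplex.mk _ _ h).Exact ∧ Epi (yonedaToRestricted k a) := by
  refine ⟨?_, ?_, ?_⟩
  · ext e t
    have : J.map t ≫ J.map δ ≫ a = 0 := by rw [h₀, comp_zero]
    exact (congrArg (· ≫ a) (J.map_comp t δ)).trans ((Category.assoc _ _ _).trans this)
  · rw [ShortComplex.exact_iff_evaluation]
    intro e
    rw [ShortComplex.moduleCat_exact_iff]
    intro t ht
    exact hk e.unop t ht
  · rw [NatTrans.epi_iff_epi_app]
    intro e
    rw [ModuleCat.epi_iff_surjective]
    intro t
    exact hs e.unop t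

namespace IsGeneratingInclusion

variable (hJ : IsGeneratingInclusion J)
include hJ

variable [J.Full] [J.Faithful]

lemma isFinitelyPresented_restrictedYoneda (X : C) :
    isFinitelyPresented k D ((restrictedYoneda k J).obj X) := by
  obtain ⟨d₁, d, δ, a, -, h₀, hs, hk⟩ := hJ.exists_presentation X
  obtain ⟨h, hex, hepi⟩ := exact_yonedaToRestricted k δ a h₀ hs
    fun e t ht => (hk e t ht).imp fun s hs => J.map_injective hs
  exact ⟨inferInstanceAs (J.op ⋙ (linearYoneda k C).obj X).Additive, d₁, d, _, _, h, hex, hepi⟩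

/-- The functor `X ↦ Hom(J -, X)` to the finitely presented functors. -/
abbrev toFinPres : C ⥤ FinPresFunctor k D :=
  (isFinitelyPresented k D).lift (restrictedYoneda k J) (hJ.isFinitelyPresented_restrictedYoneda k)

/-- A morphism from `X` is determined by its composition with an approximation `a : J d ⟶ X`. -/
lemma faithful_toFinPres : (hJ.toFinPres k).Faithful where
  map_injective {X Y f g} h := by
    obtain ⟨d, a, ha, -⟩ := hJ.exists_approximation X
    rw [← cancel_epi a]
    exact congrArg (fun φ => (φ.hom.app (op d)).hom a) h

lemma essSurj_toFinPres : (hJ.toFinPres k).EssSurj where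
  mem_essImage := by
    rintro ⟨F, hF, d₁, d, β, α, h, hex, hepi⟩
    obtain ⟨δ, rfl⟩ := (linearYoneda k D).map_surjective β
    obtain ⟨W, π, h₀, -, hs, hk⟩ := hJ.exists_weakCokernel δ
    obtain ⟨h', hex', hepi'⟩ := exact_yonedaToRestricted k δ π h₀ hs hk
    -- both functors are cokernels of the same morphism of representable functors
    have : Epi (ShortComplex.mk _ _ h).g := hepi
    have : Epi (ShortComplex.mk _ _ h').g := hepi'
    exact ⟨W, ⟨ObjectProperty.isoMk _
      (hex'.gIsCokernel.coconePointUniqueUpToIso hex.gIsCokernel)⟩⟩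

lemma isInvertedBy_toFinPres : (regularMorphisms C).IsInvertedBy (hJ.toFinPres k) := by
  rintro X Y f ⟨hm, he⟩
  have : ∀ e, IsIso (((restrictedYoneda k J).map f).app e) := fun e => by
    rw [ConcreteCategory.isIso_iff_bijective]
    exact ⟨fun s t h => (cancel_mono f).1 h, fun t => hJ.exists_lift f e.unop t⟩
  have : IsIso ((restrictedYoneda k J).map f) := NatIso.isIso_of_isIso_app _
  exact (ObjectProperty.isoMk (isFinitelyPresented k D) (X := (hJ.toFinPres k).obj X)
    (Y := (hJ.toFinPres k).obj Y) (asIso ((restrictedYoneda k J).map f))).isIso_hom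

/-- The functor `X ↦ Hom(J -, X)` exhibits the category of finitely presented functors as the
localisation of `C` at the regular morphisms. -/
theorem nonempty_localization_equivalence :
    Nonempty ((regularMorphisms C).Localization ≌ FinPresFunctor k D) := by
  have := hJ.faithful_toFinPres k
  have := hJ.essSurj_toFinPres k
  have : (regularMorphisms C).IsMultiplicative :=
    { id_mem := fun _ => ⟨inferInstance, inferInstance⟩
      comp_mem := fun f g hf hg => by
        obtain ⟨_, _⟩ := hf
        obtain ⟨_, _⟩ := hg
        exact ⟨mono_comp _ _, epi_comp _ _⟩ }
  have : (hJ.toFinPres k).IsLocalization (regularMorphisms C) :=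
    Functor.isLocalization_of_rightFractions _ _ (fun _ _ _ h => h.1)
      (hJ.isInvertedBy_toFinPres k) fun X Y φ => by
        obtain ⟨W, s, g, hs, h⟩ := hJ.exists_fraction k φ.hom
        exact ⟨W, s, g, hs, by ext : 1; exact h⟩
  exact ⟨Localization.equivalenceFromModel (hJ.toFinPres k) (regularMorphisms C)⟩

end IsGeneratingInclusion

end TwinCotorsion

/-! ### Conflations -/

namespace TwinCotorsion

variable {B : Type u} [Category.{v} B] [Preadditive B] [HasZeroObject B] [HasBinaryBiproducts B]

namespace ExactStructure

variable {E : ExactStructure B}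

section

variable {X Y Z : B} {i : X ⟶ Y} {d : Y ⟶ Z} {h : i ≫ d = 0}
  (hc : E.conf (ShortComplex.mk i d h))
include hc

lemma mono_of_conf : Mono i :=
  Fork.IsLimit.mono (E.weak _ hc).1.some

lemma epi_of_conf : Epi d :=
  Cofork.IsColimit.epi (E.weak _ hc).2.some

lemma exists_lift_of_conf {A : B} (t : A ⟶ Y) (ht : t ≫ d = 0) : ∃ s : A ⟶ X, s ≫ i = t :=
  ⟨_, (KernelFork.IsLimit.lift' (E.weak _ hc).1.some t ht).2⟩

lemma exists_desc_of_conf {A : B} (t : Y ⟶ A) (ht : i ≫ t = 0) : ∃ s : Z ⟶ A, d ≫ s = t :=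
  ⟨_, (CokernelCofork.IsColimit.desc' (E.weak _ hc).2.some t ht).2⟩

lemma isDeflation_of_conf : IsDeflation E.conf d := ⟨X, i, h, hc⟩

/-- A pushout of a conflation along a morphism out of its first term is a conflation with the same
third term. -/
lemma exists_pushout_conf {X' : B} (g : X ⟶ X') :
    ∃ (Y' : B) (g' : Y ⟶ Y') (i' : X' ⟶ Y') (d' : Y' ⟶ Z) (h' : i' ≫ d' = 0),
      IsPushout i g g' i' ∧ g' ≫ d' = d ∧ E.conf (ShortComplex.mk i' d' h') := by
  obtain ⟨Y', g', i', hp, Z'', d'', h'', hc'⟩ := E.exists_pushout i g ⟨Z, d, h, hc⟩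
  have w : i ≫ d = g ≫ (0 : X' ⟶ Z) := by rw [h, comp_zero]
  have hd₁ : g' ≫ hp.desc d 0 w = d := hp.inl_desc _ _ _
  have hd₂ : i' ≫ hp.desc d 0 w = 0 := hp.inr_desc _ _ _
  refine ⟨Y', g', i', hp.desc d 0 w, hd₂, hp, hd₁, E.of_iso _ _ ⟨?_⟩ hc'⟩
  have := epi_of_conf hc
  have := epi_of_conf hc'
  -- the two cokernels of `i'` are identified
  choose φ hφ using exists_desc_of_conf hc' _ hd₂
  choose ψ hψ using exists_desc_of_conf hc (g' ≫ d'') (by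
    rw [hp.w_assoc, h'', comp_zero])
  refine ShortComplex.isoMk (Iso.refl _) (Iso.refl _) ⟨φ, ψ, ?_, ?_⟩ (by simp)
    (by simpa using hφ.symm)
  · rw [← cancel_epi d'', reassoc_of% hφ]
    apply hp.hom_ext
    · rw [reassoc_of% hd₁, hψ]; simp
    · rw [reassoc_of% hd₂]; simp [h'']
  · rw [← cancel_epi d, reassoc_of% hψ, hφ, hd₁, Category.comp_id]

/-- If `Ext¹(Z, T₀) = 0`, morphisms to `T₀` extend along inflations with cokernel `Z`: the pushout
of the conflation splits. -/
lemma exists_extension {T₀ : B} (hT : E.ExtOneVanishes Z T₀) (f : X ⟶ T₀) :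
    ∃ e : Y ⟶ T₀, i ≫ e = f := by
  obtain ⟨Y', g', i', d', h', hp, -, hc'⟩ := exists_pushout_conf hc f
  obtain ⟨σ⟩ := hT _ _ _ _ hc'
  refine ⟨g' ≫ σ.r, ?_⟩
  have : i' ≫ σ.r = 𝟙 _ := σ.f_r
  rw [hp.w_assoc, this, Category.comp_id]

/-- Let `c : A' ⟶ W` be the pushout of the inflation `i : X ⟶ Y` along `f : X ⟶ A'`. If
`t : D ⟶ A'` vanishes in `W` up to morphisms that extend along `ι : D ⟶ P`, with `P` projective,
then `t` factors through `f` up to such morphisms. -/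
lemma exists_factor_of_isPushout {A' W : B} {f : X ⟶ A'} {f' : Y ⟶ W} {c : A' ⟶ W} {z : W ⟶ Z}
    {hz : c ≫ z = 0} (hp : IsPushout i f f' c) (hf' : f' ≫ z = d)
    (hc' : E.conf (ShortComplex.mk c z hz)) {D P : B} (hP : E.projectives P) (ι : D ⟶ P)
    (t : D ⟶ A') (e : P ⟶ W) (hte : t ≫ c = ι ≫ e) :
    ∃ (s : D ⟶ X) (m : P ⟶ A'), t = s ≫ f + ι ≫ m := by
  have := mono_of_conf hc'
  obtain ⟨l, hl⟩ := hP d (e ≫ z) (isDeflation_of_conf hc)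
  obtain ⟨m, hm⟩ := exists_lift_of_conf hc' (e - l ≫ f') (by
    rw [Preadditive.sub_comp, Category.assoc, hf', hl, sub_self])
  obtain ⟨s, hs⟩ := exists_lift_of_conf hc (ι ≫ l) (by
    rw [Category.assoc, hl, ← reassoc_of% hte, hz, comp_zero])
  refine ⟨s, m, ?_⟩
  rw [← cancel_mono c, Preadditive.add_comp, Category.assoc, Category.assoc, ← hp.w,
    reassoc_of% hs, hm, hte, ← Preadditive.comp_add]
  congr 1
  abel

end

end ExactStructure

/-! ### Quotient categories -/

lemma quotient_map_eq_zero_iff (W : ObjectProperty B) [IsAdditiveSubcategory W] {X Y : B}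
    (f : X ⟶ Y) :
    (Quotient.functor (factorRel W)).map f = 0 ↔
      ∃ (Z : B) (a : X ⟶ Z) (b : Z ⟶ Y), W Z ∧ f = a ≫ b := by
  rw [← Functor.map_zero, Quotient.functor_map_eq_iff]
  simp only [factorRel, sub_zero]

/-- The functor `B/W ⥤ B/W'` for `W ≤ W'`. -/
abbrev quotientMap {W W' : ObjectProperty B} [IsAdditiveSubcategory W]
    [IsAdditiveSubcategory W'] (hW : W ≤ W') : QuotientBy W ⥤ QuotientBy W' :=
  CategoryTheory.Quotient.lift _ (Quotient.functor (factorRel W')) (by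
    rintro X Y f g ⟨Z, a, b, hZ, e⟩
    exact CategoryTheory.Quotient.sound _ ⟨Z, a, b, hW _ hZ, e⟩)

variable {W W' : ObjectProperty B} [IsAdditiveSubcategory W] [IsAdditiveSubcategory W']
    (hW : W ≤ W')

instance : (quotientMap hW).Additive where
  map_add {X Y f g} := by
    obtain ⟨f, rfl⟩ := (Quotient.functor _).map_surjective f
    obtain ⟨g, rfl⟩ := (Quotient.functor _).map_surjective g
    rfl

instance (k : Type w) [Field k] [Linear k B] : (quotientMap hW).Linear k where
  map_smul {X Y} f c := by
    obtain ⟨f, rfl⟩ := (Quotient.functor _).map_surjective f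
    rfl

instance : (quotientMap hW).Full where
  map_surjective f := by
    obtain ⟨f, rfl⟩ := (Quotient.functor _).map_surjective f
    exact ⟨(Quotient.functor _).map f, rfl⟩

/-! ### Twin cotorsion pairs -/

namespace ExactStructure

variable {E : ExactStructure B} {S T : ObjectProperty B}

namespace IsCotorsionPair

variable (hST : E.IsCotorsionPair S T)
include hST

/-- If `P` is projective, the sequence `V ↣ U ↠ P` with `U` in `S` splits, so that `P` is a direct
summand of `U`. -/
lemma projectives_le : E.projectives ≤ S := by
  intro P hP
  obtain ⟨V, U, i, d, h, hc, hU, -⟩ := hST.exists_right P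
  obtain ⟨σ, hσ⟩ := hP d (𝟙 P) (isDeflation_of_conf hc)
  obtain ⟨ρ, hρ⟩ := exists_lift_of_conf hc (𝟙 U - d ≫ σ) (by simp [hσ])
  have := mono_of_conf hc
  let s : ShortComplex.Splitting (ShortComplex.mk i d h) :=
    { s := σ
      r := ρ
      f_r := by
        rw [← cancel_mono i]
        simp [hρ, reassoc_of% h]
      s_g := hσ
      id := by simp [hρ] }
  exact hST.summands_left _ _ _ ⟨s.isoBinaryBiproduct ≪≫ biprod.braiding _ _⟩ hU

end IsCotorsionPair

section

variable [IsAdditiveSubcategory T] (hPT : E.projectives ≤ T)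

/-- The functor `ΩS/𝒫 ⥤ B/T` induced by the identity of `B`. It is fully faithful, see
`IsCotorsionPair.faithful_syzygyInclusion`. -/
abbrev syzygyInclusion : E.StableSyzygies S ⥤ QuotientBy T :=
  ObjectProperty.ι _ ⋙ quotientMap hPT

variable {hPT} (hST : E.IsCotorsionPair S T)
include hST

/-- A morphism from a syzygy `D ↣ P` that vanishes in `B/T` extends to `P`. -/
lemma IsCotorsionPair.exists_factor {D P Y Z : B} {i : D ⟶ P} {d : P ⟶ Z} {h : i ≫ d = 0}
    (hc : E.conf (ShortComplex.mk i d h)) (hZ : S Z) {f : D ⟶ Y}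
    (hf : (Quotient.functor (factorRel T)).map f = 0) : ∃ e : P ⟶ Y, f = i ≫ e := by
  obtain ⟨T₀, a, b, hT, rfl⟩ := (quotient_map_eq_zero_iff T f).1 hf
  obtain ⟨e, rfl⟩ := exists_extension hc (hST.ext_vanishes _ _ hZ hT) a
  exact ⟨e ≫ b, Category.assoc _ _ _⟩

omit hST in
lemma quotient_map_comp_eq_zero {P X Y : B} (hP : T P) (a : X ⟶ P) (b : P ⟶ Y) :
    (Quotient.functor (factorRel T)).map (a ≫ b) = 0 :=
  (quotient_map_eq_zero_iff T _).2 ⟨P, a, b, hP, rfl⟩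

/-- A morphism from a syzygy `D ↣ P` that factors through `T` already factors through the projective
object `P`. -/
lemma IsCotorsionPair.faithful_syzygyInclusion :
    (syzygyInclusion (S := S) hPT).Faithful := by
  have key : ∀ {X Y : E.StableSyzygies S} (u : X ⟶ Y),
      (syzygyInclusion (S := S) hPT).map u = 0 → u = 0 := by
    rintro ⟨⟨X⟩, P, Z, i, d, h, hc, hP, hZ⟩ ⟨⟨Y⟩, hY⟩ ⟨u⟩ hu
    obtain ⟨u, rfl⟩ := (Quotient.functor _).map_surjective u
    obtain ⟨e, rfl⟩ := hST.exists_factor hc hZ (f := u) hu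
    ext : 1
    exact (quotient_map_eq_zero_iff _ _).2 ⟨P, i, e, hP, rfl⟩
  exact ⟨fun {X Y f g} h => sub_eq_zero.1 (key _ (by rw [Functor.map_sub, h, sub_self]))⟩

include hPT

/-- Let `X ↣ TX ↠ SX` be the conflation of the cotorsion pair, and `D ↣ P ↠ SX` a conflation with
`P` projective. A lift `P ⟶ TX` of `P ↠ SX` restricts to a morphism `D ⟶ X`, which in `B/T` is an
epimorphism and a right approximation of `X` by syzygies. -/
lemma IsCotorsionPair.exists_approximation (hE : E.EnoughProjectives) (X : B) :
    ∃ (D : B) (_ : E.syzygies S D) (a : D ⟶ X),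
      Epi ((Quotient.functor (factorRel T)).map a) ∧
      ∀ (D' : B) (_ : E.syzygies S D') (t : D' ⟶ X), ∃ s : D' ⟶ D,
        (Quotient.functor (factorRel T)).map (s ≫ a) = (Quotient.functor (factorRel T)).map t := by
  obtain ⟨TX, SX, x, y, hxy, hc, hS, hT⟩ := hST.exists_left X
  obtain ⟨P, p, hP, D, j, hjp, hc'⟩ := hE SX
  have := mono_of_conf hc
  have := epi_of_conf hc'
  obtain ⟨q, hq⟩ := hP y p (isDeflation_of_conf hc)
  obtain ⟨a, ha⟩ := exists_lift_of_conf hc (j ≫ q) (by rw [Category.assoc, hq, hjp])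
  refine ⟨D, ⟨P, SX, j, p, hjp, hc', hP, hS⟩, a, Preadditive.epi_of_cancel_zero _ ?_, ?_⟩
  · intro Y g hg
    obtain ⟨g, rfl⟩ := (Quotient.functor _).map_surjective g
    rw [← Functor.map_comp] at hg
    obtain ⟨h, hh⟩ := hST.exists_factor hc' hS hg
    -- `g` extends to `TX`, since the pushout along `g` of the conflation `X ↣ TX ↠ SX` splits
    obtain ⟨E', g', x', y', hxy', hp, hgy, hc''⟩ := exists_pushout_conf hc g
    obtain ⟨σ, hσ⟩ := exists_desc_of_conf hc' (q ≫ g' - h ≫ x') (by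
      rw [Preadditive.comp_sub, ← reassoc_of% ha, hp.w, ← reassoc_of% hh, sub_self])
    have hσy : σ ≫ y' = 𝟙 SX := by
      rw [← cancel_epi p, reassoc_of% hσ, Preadditive.sub_comp, Category.assoc, Category.assoc,
        hgy, hq, hxy', comp_zero, sub_zero, Category.comp_id]
    obtain ⟨w, hw⟩ := exists_lift_of_conf hc'' (g' - y ≫ σ) (by
      rw [Preadditive.sub_comp, Category.assoc, hσy, hgy, Category.comp_id, sub_self])
    have hxw : g = x ≫ w := by
      have := mono_of_conf hc''
      rw [← cancel_mono x', Category.assoc, hw, Preadditive.comp_sub, hp.w, reassoc_of% hxy,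
        zero_comp, sub_zero]
    rw [hxw]
    exact quotient_map_comp_eq_zero hT x w
  · rintro D' ⟨P', Z', i, d, hid, hc₁, hP', hZ'⟩ t
    obtain ⟨e, he⟩ := exists_extension hc₁ (hST.ext_vanishes _ _ hZ' hT) (t ≫ x)
    obtain ⟨e', he'⟩ := hP' p (e ≫ y) (isDeflation_of_conf hc')
    obtain ⟨m, hm⟩ := exists_lift_of_conf hc (e - e' ≫ q) (by
      rw [Preadditive.sub_comp, Category.assoc, hq, he', sub_self])
    obtain ⟨s, hs⟩ := exists_lift_of_conf hc' (i ≫ e') (by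
      rw [Category.assoc, he', reassoc_of% he, hxy, comp_zero])
    refine ⟨s, ?_⟩
    have : t = s ≫ a + i ≫ m := by
      rw [← cancel_mono x, Preadditive.add_comp, Category.assoc, Category.assoc, ha, hm,
        reassoc_of% hs, ← he, ← Preadditive.comp_add, add_sub_cancel]
    rw [this, Functor.map_add, quotient_map_comp_eq_zero (hPT _ hP'), add_zero]

/-- The weak kernel of `f : X ⟶ Y` is the pullback along `f` of a deflation from a projective
object. -/
lemma IsCotorsionPair.exists_weakKernel (hE : E.EnoughProjectives) {X Y : B} (f : X ⟶ Y) :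
    ∃ (K : B) (κ : K ⟶ X), (Quotient.functor (factorRel T)).map (κ ≫ f) = 0 ∧
      ∀ (D : B) (_ : E.syzygies S D) (t : D ⟶ X),
        (Quotient.functor (factorRel T)).map (t ≫ f) = 0 → ∃ s : D ⟶ K, s ≫ κ = t := by
  obtain ⟨Q, p, hQ, hp⟩ := hE Y
  obtain ⟨K, q, κ, hK, -⟩ := E.exists_pullback p f hp
  refine ⟨K, κ, ?_, ?_⟩
  · rw [← hK.w]
    exact quotient_map_comp_eq_zero (hPT _ hQ) _ _
  · rintro D ⟨P, Z, i, d, hid, hc, hP, hZ⟩ t ht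
    obtain ⟨e, he⟩ := hST.exists_factor hc hZ ht
    obtain ⟨e', rfl⟩ := hP p e hp
    exact ⟨hK.lift (i ≫ e') t (by rw [he, Category.assoc]), hK.lift_snd _ _ _⟩

/-- Let `c : Y ⟶ W` be the pushout along `f : X ⟶ Y` of an inflation `X ↣ TX` with `TX` in `T`. If
`f` is an epimorphism in `B/T`, then `c` vanishes there, so that every morphism from a syzygy to `Y`
factors through `f`. -/
lemma IsCotorsionPair.exists_lift_of_epi {X Y : B} (f : X ⟶ Y)
    (hf : Epi ((Quotient.functor (factorRel T)).map f)) {D : B} (hD : E.syzygies S D)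
    (t : D ⟶ Y) : ∃ s : D ⟶ X,
      (Quotient.functor (factorRel T)).map (s ≫ f) = (Quotient.functor (factorRel T)).map t := by
  obtain ⟨TX, SX, x, y, hxy, hc, hS, hT⟩ := hST.exists_left X
  obtain ⟨W, f', c, z, hcz, hp, hf', hc'⟩ := exists_pushout_conf hc f
  have hc₀ : (Quotient.functor (factorRel T)).map c = 0 := by
    rw [← cancel_epi ((Quotient.functor (factorRel T)).map f), ← Functor.map_comp, ← hp.w,
      comp_zero]
    exact quotient_map_comp_eq_zero hT _ _
  obtain ⟨P, Z, i, d, hid, hcD, hP, hZ⟩ := hD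
  obtain ⟨e, he⟩ := hST.exists_factor hcD hZ (f := t ≫ c) (by
    rw [Functor.map_comp, hc₀, comp_zero])
  obtain ⟨s, m, hsm⟩ := exists_factor_of_isPushout hc hp hf' hc' hP i t e he
  refine ⟨s, ?_⟩
  rw [hsm, Functor.map_add, quotient_map_comp_eq_zero (hPT _ hP), add_zero]

/-- The weak cokernel of `δ : D₁ ⟶ D`, with `D₁ ↣ P₁` a syzygy, is the pushout of `D₁ ↣ P₁` along
`δ`. -/
lemma IsCotorsionPair.exists_weakCokernel (hS : S ≤ T) {D₁ D : B} (hD₁ : E.syzygies S D₁)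
    (δ : D₁ ⟶ D) : ∃ (W : B) (π : D ⟶ W),
      (Quotient.functor (factorRel T)).map (δ ≫ π) = 0 ∧
      (∀ (Y : B) (y : D ⟶ Y), (Quotient.functor (factorRel T)).map (δ ≫ y) = 0 →
        ∃ r : W ⟶ Y, π ≫ r = y) ∧
      (∀ (D' : B) (_ : E.syzygies S D') (t : D' ⟶ W), ∃ s : D' ⟶ D,
        (Quotient.functor (factorRel T)).map (s ≫ π) =
          (Quotient.functor (factorRel T)).map t) ∧
      (∀ (D' : B) (_ : E.syzygies S D') (t : D' ⟶ D),
        (Quotient.functor (factorRel T)).map (t ≫ π) = 0 → ∃ s : D' ⟶ D₁,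
        (Quotient.functor (factorRel T)).map (s ≫ δ) =
          (Quotient.functor (factorRel T)).map t) := by
  obtain ⟨P₁, S₁, i₁, d₁, h₁, hc, hP₁, hS₁⟩ := hD₁
  obtain ⟨W, p, π, z, hπz, hp, hpz, hc'⟩ := exists_pushout_conf hc δ
  refine ⟨W, π, ?_, ?_, ?_, ?_⟩
  · rw [← hp.w]
    exact quotient_map_comp_eq_zero (hPT _ hP₁) _ _
  · intro Y y hy
    obtain ⟨e, he⟩ := hST.exists_factor hc hS₁ hy
    exact ⟨hp.desc e y he.symm, hp.inr_desc _ _ _⟩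
  · rintro D' ⟨P, Z, i, d, hid, hcD, hP, hZ⟩ t
    obtain ⟨e, he⟩ := exists_extension hcD (hST.ext_vanishes _ _ hZ (hS _ hS₁)) (t ≫ z)
    obtain ⟨e', rfl⟩ := hP z e (isDeflation_of_conf hc')
    obtain ⟨s, hs⟩ := exists_lift_of_conf hc' (t - i ≫ e') (by
      rw [Preadditive.sub_comp, Category.assoc, he, sub_self])
    refine ⟨s, ?_⟩
    rw [hs, Functor.map_sub, quotient_map_comp_eq_zero (hPT _ hP), sub_zero]
  · rintro D' ⟨P, Z, i, d, hid, hcD, hP, hZ⟩ t ht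
    obtain ⟨e, he⟩ := hST.exists_factor hcD hZ ht
    obtain ⟨s, m, hsm⟩ := exists_factor_of_isPushout hc hp hpz hc' hP i t e he
    refine ⟨s, ?_⟩
    rw [hsm, Functor.map_add, quotient_map_comp_eq_zero (hPT _ hP), add_zero]

theorem IsCotorsionPair.isGeneratingInclusion (hE : E.EnoughProjectives) (hS : S ≤ T) :
    IsGeneratingInclusion (syzygyInclusion (S := S) hPT) where
  exists_approximation := by
    rintro ⟨X⟩
    obtain ⟨D, hD, a, ha, hs⟩ := hST.exists_approximation (hPT := hPT) hE X
    refine ⟨⟨⟨D⟩, hD⟩, (Quotient.functor _).map a, ha, ?_⟩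
    rintro ⟨⟨D'⟩, hD'⟩ t
    obtain ⟨t, rfl⟩ := (Quotient.functor _).map_surjective t
    obtain ⟨s, hs⟩ := hs D' hD' t
    exact ⟨ObjectProperty.homMk ((Quotient.functor _).map s), hs⟩
  exists_weakKernel := by
    rintro ⟨X⟩ ⟨Y⟩ f
    obtain ⟨f, rfl⟩ := (Quotient.functor _).map_surjective f
    obtain ⟨K, κ, hκ, h⟩ := hST.exists_weakKernel (hPT := hPT) hE f
    refine ⟨⟨K⟩, (Quotient.functor _).map κ, hκ, ?_⟩
    rintro ⟨⟨D⟩, hD⟩ t ht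
    obtain ⟨t, rfl⟩ := (Quotient.functor _).map_surjective t
    obtain ⟨s, rfl⟩ := h D hD t ht
    exact ⟨(Quotient.functor _).map s, rfl⟩
  exists_lift := by
    rintro ⟨X⟩ ⟨Y⟩ f hf ⟨⟨D⟩, hD⟩ t
    obtain ⟨f, rfl⟩ := (Quotient.functor _).map_surjective f
    obtain ⟨t, rfl⟩ := (Quotient.functor _).map_surjective t
    obtain ⟨s, hs⟩ := hST.exists_lift_of_epi (hPT := hPT) f hf hD t
    exact ⟨(Quotient.functor _).map s, hs⟩
  exists_weakCokernel := by
    have := hST.faithful_syzygyInclusion (hPT := hPT)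
    rintro ⟨⟨D₁⟩, hD₁⟩ ⟨⟨D⟩, hD⟩ ⟨δ⟩
    obtain ⟨δ, rfl⟩ := (Quotient.functor _).map_surjective δ
    obtain ⟨W, π, h₀, h₁, h₂, h₃⟩ := hST.exists_weakCokernel (hPT := hPT) hS hD₁ δ
    refine ⟨⟨W⟩, (Quotient.functor _).map π, h₀, ?_, ?_, ?_⟩
    · rintro ⟨Y⟩ y hy
      obtain ⟨y, rfl⟩ := (Quotient.functor _).map_surjective y
      obtain ⟨r, rfl⟩ := h₁ Y y hy
      exact ⟨(Quotient.functor _).map r, rfl⟩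
    · rintro ⟨⟨D'⟩, hD'⟩ t
      obtain ⟨t, rfl⟩ := (Quotient.functor _).map_surjective t
      obtain ⟨s, hs⟩ := h₂ D' hD' t
      exact ⟨ObjectProperty.homMk ((Quotient.functor _).map s), hs⟩
    · rintro ⟨⟨D'⟩, hD'⟩ ⟨t⟩ ht
      obtain ⟨t, rfl⟩ := (Quotient.functor _).map_surjective t
      obtain ⟨s, hs⟩ := h₃ D' hD' t ht
      exact ⟨ObjectProperty.homMk ((Quotient.functor _).map s),
        (syzygyInclusion (S := S) hPT).map_injective hs⟩

end

end ExactStructure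

end TwinCotorsion

theorem theorem9 {k : Type w} [Field k] {B : Type u} [Category.{v} B] [Preadditive B]
    [HasZeroObject B] [HasBinaryBiproducts B] [Linear k B] [EssentiallySmall.{v} B]
    (hKS : TwinCotorsion.IsKrullSchmidt B) (E : TwinCotorsion.ExactStructure B)
    (hP : E.EnoughProjectives) (hI : E.EnoughInjectives)
    (S T V : ObjectProperty B) (hST : E.IsTwinCotorsionPair S T T V) :
    Nonempty
      ((TwinCotorsion.regularMorphisms (TwinCotorsion.QuotientBy T)).Localization ≌
        TwinCotorsion.FinPresFunctor k (E.StableSyzygies S)) := by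
  have := hST.left.additive_right
  have hPT : E.projectives ≤ T := hST.left.projectives_le.trans hST.le
  have := hST.left.faithful_syzygyInclusion (hPT := hPT)
  exact (hST.left.isGeneratingInclusion (hPT := hPT) hP hST.le).nonempty_localization_equivalence k
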